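/- Conventions. Let $A$ be a ring with unit and $\mathfrak C$ an $A$-coring with comultiplication $\Delta$ and counit $\varepsilon$. A (not necessarily unital) ring $R$ is firm if the multiplication map $R\otimes_R R\to R$ is bijective, and a left $R$-module $N$ is firm if $R\otimes_R N\to N$, $r\otimes n\mapsto rn$, is bijective. For a firm ring $R$, ${}_R\mathcal M^{\mathfrak C}$ denotes the category of right $\mathfrak C$-comodules $(\Sigma,\rho)$, $\rho(u)=u_{[0]}\otimes_A u_{[1]}$, that are also firm left $R$-modules such that $\Sigma$ is an $R$-$A$-bimodule and $\rho$ is left $R$-linear. Such a $\Sigma$ is called *$R$-$\mathfrak C$ comonadic-Galois* if for every right $A$-module $M$ the map $$\mathsf{can}_M:\mathrm{Hom}_A(\Sigma,M)\otimes_R\Sigma\to M\otimes_A\mathfrak C,\qquad \mathsf{can}_M(f\otimes_R u)=f(u_{[0]})\otimes_A u_{[1]},$$ is an isomorphism, where $R$ acts on $\mathrm{Hom}_A(\Sigma,M)$ by $(fr)(u)=f(ru)$. Theorem. Let $\mathfrak C$ be an $A$-coring, $R$ a firm ring and $\Sigma\in{}_R\mathcal M^{\mathfrak C}$. Let $T=\mathrm{End}^{\mathfrak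 C}(\Sigma)$ be the unital ring of right $\mathfrak C$-colinear endomorphisms of $\Sigma$, with composition as multiplication, so that $\Sigma\in{}_T\mathcal M^{\mathfrak C}$, and let $\jmath:R\to T$, $\jmath(r)(u)=ru$, be the canonical ring morphism. (i) If $\Sigma$ is $R$-$\mathfrak C$ comonadic-Galois, then $\Sigma$ is $T$-$\mathfrak C$ comonadic-Galois (i.e. a Galois comodule in the sense of Wisbauer). (ii) If $R$ is a left ideal in $T$ (that is, $\jmath(R)$ is a left ideal of $T$) and $\Sigma$ is $T$-$\mathfrak C$ comonadic-Galois, then $\Sigma$ is $R$-$\mathfrak C$ comonadic-Galois; hence, when $R$ is a left ideal in $T$, the two properties are equivalent. -/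

import Mathlib

open MulOpposite

universe u

/-! ## Tensor products over a (possibly non-unital, non-commutative) ring -/

/-- The tensor product `M ⊗_R N` of a right `R`-module `M` and a left `R`-module `N`: the quotient
of `M ⊗_ℤ N` by the subgroup generated by all `(m r) ⊗ n - m ⊗ (r n)`. A right action of `R` is
written as an action of `Rᵐᵒᵖ`. -/
def BT (R M N : Type u) [AddCommGroup M] [AddCommGroup N] [SMul Rᵐᵒᵖ M] [SMul R N] : Type u :=
  TensorProduct ℤ M N ⧸ AddSubgroup.closure
    {x : TensorProduct ℤ M N | ∃ (m : M) (r : R) (n : N),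
      x = TensorProduct.tmul ℤ (op r • m) n - TensorProduct.tmul ℤ m (r • n)}

namespace BT

section Basic

variable (R : Type u) {M N M' N' Q : Type u} [AddCommGroup M] [AddCommGroup N] [AddCommGroup M']
  [AddCommGroup N'] [AddCommGroup Q] [SMul Rᵐᵒᵖ M] [SMul R N] [SMul Rᵐᵒᵖ M'] [SMul R N']

instance : AddCommGroup (BT R M N) :=
  inferInstanceAs (AddCommGroup (TensorProduct ℤ M N ⧸ AddSubgroup.closure
    {x : TensorProduct ℤ M N | ∃ (m : M) (r : R) (n : N),
      x = TensorProduct.tmul ℤ (op r • m) n - TensorProduct.tmul ℤ m (r • n)}))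

/-- The pure tensor `m ⊗_R n`. -/
def tmul (m : M) (n : N) : BT R M N :=
  QuotientAddGroup.mk (TensorProduct.tmul ℤ m n)

/-- The additive map on `M ⊗_R N` induced by an `R`-balanced biadditive map. -/
def lift (f : M →+ N →+ Q) (hf : ∀ (m : M) (r : R) (n : N), f (op r • m) n = f m (r • n)) :
    BT R M N →+ Q :=
  QuotientAddGroup.lift _
    (TensorProduct.liftAddHom f (fun z m n => by simp))
    (by
      rw [AddSubgroup.closure_le]
      rintro _ ⟨m, r, n, rfl⟩
      simp [hf])

@[simp] theorem lift_tmul (f : M →+ N →+ Q)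
    (hf : ∀ (m : M) (r : R) (n : N), f (op r • m) n = f m (r • n)) (m : M) (n : N) :
    lift R f hf (tmul R m n) = f m n := rfl

theorem add_tmul (m m' : M) (n : N) : tmul R (m + m') n = tmul R m n + tmul R m' n :=
  congrArg QuotientAddGroup.mk (TensorProduct.add_tmul m m' n)

theorem tmul_add (m : M) (n n' : N) : tmul R m (n + n') = tmul R m n + tmul R m n' :=
  congrArg QuotientAddGroup.mk (TensorProduct.tmul_add m n n')

theorem smul_tmul (m : M) (r : R) (n : N) : tmul R (op r • m) n = tmul R m (r • n) := by
  apply Eq.symm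
  refine QuotientAddGroup.eq.2 ?_
  refine AddSubgroup.subset_closure ⟨m, r, n, ?_⟩
  abel

/-- The biadditive map `(m, n) ↦ m ⊗_R n`. -/
def mk : M →+ N →+ BT R M N :=
  AddMonoidHom.mk' (fun m => AddMonoidHom.mk' (fun n => tmul R m n) (tmul_add R m))
    (fun m m' => by ext n; exact add_tmul R m m' n)

@[simp] theorem mk_apply (m : M) (n : N) : mk R m n = tmul R m n := rfl

@[elab_as_elim]
theorem induction {p : BT R M N → Prop} (x : BT R M N) (zero : p 0)
    (tmul : ∀ m n, p (tmul R m n)) (add : ∀ x y, p x → p y → p (x + y)) : p x := by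
  refine QuotientAddGroup.induction_on x fun x => ?_
  induction x using TensorProduct.induction_on with
  | zero => exact zero
  | tmul m n => exact tmul m n
  | add x y hx hy => exact add _ _ hx hy

/-- `f ⊗_R g : M ⊗_R N → M' ⊗_R N'` for a right `R`-linear `f` and a left `R`-linear `g`. -/
def map (f : M →+ M') (g : N →+ N') (hf : ∀ (r : R) (m : M), f (op r • m) = op r • f m)
    (hg : ∀ (r : R) (n : N), g (r • n) = r • g n) : BT R M N →+ BT R M' N' :=
  lift R (((mk R).comp f).compl₂ g)
    (fun m r n => by simp [hf, hg, smul_tmul])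

@[simp] theorem map_tmul (f : M →+ M') (g : N →+ N')
    (hf : ∀ (r : R) (m : M), f (op r • m) = op r • f m)
    (hg : ∀ (r : R) (n : N), g (r • n) = r • g n) (m : M) (n : N) :
    map R f g hf hg (tmul R m n) = tmul R (f m) (g n) := rfl

end Basic

section Right

variable {R B M N : Type u} [Ring B] [AddCommGroup M] [AddCommGroup N] [SMul Rᵐᵒᵖ M] [SMul R N]
  [Module Bᵐᵒᵖ N] [SMulCommClass R Bᵐᵒᵖ N]

/-- If `N` is an `R`-`B`-bimodule then `B` acts on `M ⊗_R N` from the right, through `N`. -/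
instance rightSMul : SMul Bᵐᵒᵖ (BT R M N) where
  smul b := map R (AddMonoidHom.id M) (DistribSMul.toAddMonoidHom N b) (fun _ _ => rfl)
    (fun r n => (smul_comm r b n).symm)

@[simp] theorem right_smul_tmul (b : Bᵐᵒᵖ) (m : M) (n : N) :
    b • tmul R m n = tmul R m (b • n) := rfl

instance rightModule : Module Bᵐᵒᵖ (BT R M N) where
  smul_zero b := map_zero (map R (AddMonoidHom.id M) (DistribSMul.toAddMonoidHom N b) _ _)
  smul_add b := map_add (map R (AddMonoidHom.id M) (DistribSMul.toAddMonoidHom N b) _ _)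
  one_smul x := by
    induction x using BT.induction with
    | zero => exact map_zero (map R (AddMonoidHom.id M) (DistribSMul.toAddMonoidHom N 1) _ _)
    | tmul m n => rw [right_smul_tmul, one_smul]
    | add x y hx hy =>
      exact (map_add (map R (AddMonoidHom.id M) (DistribSMul.toAddMonoidHom N 1) _ _) x y).trans
        (congrArg₂ (· + ·) hx hy)
  mul_smul b c x := by
    have h (d : Bᵐᵒᵖ) (x y : BT R M N) : d • (x + y) = d • x + d • y :=
      map_add (map R (AddMonoidHom.id M) (DistribSMul.toAddMonoidHom N d) _ _) x y
    have h0 (d : Bᵐᵒᵖ) : d • (0 : BT R M N) = 0 :=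
      map_zero (map R (AddMonoidHom.id M) (DistribSMul.toAddMonoidHom N d) _ _)
    induction x using BT.induction with
    | zero => simp only [h0]
    | tmul m n => simp only [right_smul_tmul, mul_smul]
    | add x y hx hy => simp only [h, hx, hy]
  add_smul b c x := by
    have h (d : Bᵐᵒᵖ) (x y : BT R M N) : d • (x + y) = d • x + d • y :=
      map_add (map R (AddMonoidHom.id M) (DistribSMul.toAddMonoidHom N d) _ _) x y
    have h0 (d : Bᵐᵒᵖ) : d • (0 : BT R M N) = 0 :=
      map_zero (map R (AddMonoidHom.id M) (DistribSMul.toAddMonoidHom N d) _ _)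
    induction x using BT.induction with
    | zero => simp only [h0, add_zero]
    | tmul m n => simp only [right_smul_tmul, add_smul, tmul_add]
    | add x y hx hy => rw [h, h, h, hx, hy]; abel
  zero_smul x := by
    have h (d : Bᵐᵒᵖ) (x y : BT R M N) : d • (x + y) = d • x + d • y :=
      map_add (map R (AddMonoidHom.id M) (DistribSMul.toAddMonoidHom N d) _ _) x y
    induction x using BT.induction with
    | zero => exact map_zero (map R (AddMonoidHom.id M) (DistribSMul.toAddMonoidHom N 0) _ _)
    | tmul m n => rw [right_smul_tmul, zero_smul]; exact map_zero (mk R m)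
    | add x y hx hy => rw [h, hx, hy, add_zero]

end Right

section Left

variable {A M N : Type u} [Ring A] [AddCommGroup M] [AddCommGroup N] [Module A M] [Module Aᵐᵒᵖ M]
  [SMulCommClass A Aᵐᵒᵖ M] [SMul A N]

/-- If `M` is an `A`-bimodule then `A` acts on `M ⊗_A N` from the left, through `M`. -/
instance leftSMul : SMul A (BT A M N) where
  smul a := map A (DistribSMul.toAddMonoidHom M a) (AddMonoidHom.id N)
    (fun b m => smul_comm a (op b) m) (fun _ _ => rfl)

@[simp] theorem left_smul_tmul (a : A) (m : M) (n : N) :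
    a • tmul A m n = tmul A (a • m) n := rfl

end Left

section Assoc

variable (A : Type u) {M N Q : Type u} [Ring A] [AddCommGroup M] [AddCommGroup N] [AddCommGroup Q]
  [Module Aᵐᵒᵖ M] [Module A N] [Module Aᵐᵒᵖ N] [SMulCommClass A Aᵐᵒᵖ N] [Module A Q]

/-- The map `m ⊗ n ↦ (q ↦ m ⊗ (n ⊗ q))`. -/
def assocAux : BT A M N →+ Q →+ BT A M (BT A N Q) :=
  lift A
    (AddMonoidHom.mk' (fun m => AddMonoidHom.mk' (fun n => (mk A m).comp (mk A n))
      (fun n n' => by ext q; simp [tmul_add]))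
      (fun m m' => by ext n q; simp))
    (fun m a n => by ext q; simp [smul_tmul])

theorem assocAux_tmul (m : M) (n : N) (q : Q) :
    assocAux A (tmul A m n) q = tmul A m (tmul A n q) := rfl

/-- The canonical map `(M ⊗_A N) ⊗_A Q → M ⊗_A (N ⊗_A Q)`, `(m ⊗ n) ⊗ q ↦ m ⊗ (n ⊗ q)`. -/
def assoc : BT A (BT A M N) Q →+ BT A M (BT A N Q) :=
  lift A (assocAux A) (fun x a q => by
    induction x using BT.induction with
    | zero => rw [smul_zero, map_zero]; rfl
    | tmul m n => rw [right_smul_tmul, assocAux_tmul, assocAux_tmul, smul_tmul]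
    | add x y hx hy =>
      rw [smul_add, map_add, map_add, AddMonoidHom.add_apply, AddMonoidHom.add_apply, hx, hy])

@[simp] theorem assoc_tmul (m : M) (n : N) (q : Q) :
    assoc A (tmul A (tmul A m n) q) = tmul A m (tmul A n q) := rfl

end Assoc

end BT

/-! ## Corings and comodules -/

/-- An `A`-coring structure on the (unital) `A`-bimodule `C`. -/
class Coring (A C : Type u) [Ring A] [AddCommGroup C] [Module A C] [Module Aᵐᵒᵖ C]
    [SMulCommClass A Aᵐᵒᵖ C] where
  /-- the comultiplication `Δ : C → C ⊗_A C` -/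
  comul : C →+ BT A C C
  comul_left : ∀ (a : A) (c : C), comul (a • c) = a • comul c
  comul_right : ∀ (a : A) (c : C), comul (op a • c) = op a • comul c
  /-- the counit `ε : C → A` -/
  counit : C →+ A
  counit_left : ∀ (a : A) (c : C), counit (a • c) = a * counit c
  counit_right : ∀ (a : A) (c : C), counit (op a • c) = counit c * a
  /-- `(C ⊗ Δ) ∘ Δ = (Δ ⊗ C) ∘ Δ` -/
  coassoc : ∀ c : C,
    BT.assoc A (BT.map A comul (AddMonoidHom.id C) comul_right (fun _ _ => rfl) (comul c)) =
      BT.map A (AddMonoidHom.id C) comul (fun _ _ => rfl) comul_left (comul c)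
  /-- `(ε ⊗ C) ∘ Δ = C`, up to `A ⊗_A C ≅ C` -/
  counit_comul : ∀ c : C,
    BT.lift A (((AddMonoidHom.smul : A →+ C →+ C)).comp counit)
      (fun c a d => by simp [counit_right, mul_smul]) (comul c) = c
  /-- `(C ⊗ ε) ∘ Δ = C`, up to `C ⊗_A A ≅ C` -/
  comul_counit : ∀ c : C,
    BT.lift A (((AddMonoidHom.smul : Aᵐᵒᵖ →+ C →+ C).comp
        (opAddEquiv.toAddMonoidHom.comp counit)).flip)
      (fun c a d => by simp [counit_left, mul_smul]) (comul c) = c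

/-- A right `C`-comodule structure on the right `A`-module `P`, for an `A`-coring `C`. -/
class RightComodule (A C P : Type u) [Ring A] [AddCommGroup C] [Module A C] [Module Aᵐᵒᵖ C]
    [SMulCommClass A Aᵐᵒᵖ C] [Coring A C] [AddCommGroup P] [Module Aᵐᵒᵖ P] where
  /-- the coaction `ρ : P → P ⊗_A C` -/
  coact : P →+ BT A P C
  coact_right : ∀ (a : A) (u : P), coact (op a • u) = op a • coact u
  /-- `(ρ ⊗ C) ∘ ρ = (P ⊗ Δ) ∘ ρ` -/
  coassoc : ∀ u : P,
    BT.assoc A (BT.map A coact (AddMonoidHom.id C) coact_right (fun _ _ => rfl) (coact u)) =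
      BT.map A (AddMonoidHom.id P) (Coring.comul (A := A)) (fun _ _ => rfl) Coring.comul_left (coact u)
  /-- `(P ⊗ ε) ∘ ρ = P`, up to `P ⊗_A A ≅ P` -/
  coact_counit : ∀ u : P,
    BT.lift A (((AddMonoidHom.smul : Aᵐᵒᵖ →+ P →+ P).comp
        (opAddEquiv.toAddMonoidHom.comp (Coring.counit (A := A) (C := C)))).flip)
      (fun u a c => by simp [Coring.counit_left, mul_smul]) (coact u) = u

section RTensor

variable (A C : Type u) {P M : Type u} [Ring A] [AddCommGroup C] [Module A C] [AddCommGroup P]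
  [Module Aᵐᵒᵖ P] [AddCommGroup M] [Module Aᵐᵒᵖ M]

/-- For a right `A`-linear `f : P → M`, the map `f ⊗_A C : P ⊗_A C → M ⊗_A C`. -/
def rTensor (f : P →ₗ[Aᵐᵒᵖ] M) : BT A P C →+ BT A M C :=
  BT.map A f.toAddMonoidHom (AddMonoidHom.id C) (fun a u => f.map_smul (op a) u) (fun _ _ => rfl)

@[simp] theorem rTensor_tmul (f : P →ₗ[Aᵐᵒᵖ] M) (u : P) (c : C) :
    rTensor A C f (BT.tmul A u c) = BT.tmul A (f u) c := rfl

end RTensor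

section Comodule

variable (A C P : Type u) [Ring A] [AddCommGroup C] [Module A C] [Module Aᵐᵒᵖ C]
  [SMulCommClass A Aᵐᵒᵖ C] [Coring A C] [AddCommGroup P] [Module Aᵐᵒᵖ P] [RightComodule A C P]

/-- The right `A`-linear endomorphism `f` of the comodule `P` is `C`-colinear:
`ρ ∘ f = (f ⊗_A C) ∘ ρ`. -/
def IsColinear (f : P →ₗ[Aᵐᵒᵖ] P) : Prop :=
  ∀ u : P, RightComodule.coact (A := A) (C := C) (f u) =
    rTensor A C f (RightComodule.coact (A := A) (C := C) u)

/-- The ring `T = End^C(P)` of right `C`-colinear endomorphisms of `P`, with composition as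
multiplication. It acts on `P` from the left by evaluation. -/
def ComoduleEnd : Subring (Module.End Aᵐᵒᵖ P) where
  carrier := {f | IsColinear A C P f}
  one_mem' u := by
    change RightComodule.coact (A := A) (C := C) u = _
    generalize RightComodule.coact (A := A) (C := C) u = x
    induction x using BT.induction with
    | zero => rw [map_zero]
    | tmul m n => rfl
    | add x y hx hy => rw [map_add, ← hx, ← hy]
  mul_mem' {f g} hf hg u := by
    rw [Module.End.mul_apply, hf, hg]
    generalize RightComodule.coact (A := A) (C := C) u = x
    induction x using BT.induction with
    | zero => simp only [map_zero]
    | tmul m n => rfl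
    | add x y hx hy => simp only [map_add, hx, hy]
  zero_mem' u := by
    generalize RightComodule.coact (A := A) (C := C) u = x
    rw [LinearMap.zero_apply, map_zero]
    induction x using BT.induction with
    | zero => rw [map_zero]
    | tmul m n => exact (DFunLike.congr_fun (map_zero (BT.mk A (M := P) (N := C))) n).symm
    | add x y hx hy => rw [map_add, ← hx, ← hy, add_zero]
  add_mem' {f g} hf hg u := by
    rw [LinearMap.add_apply, map_add, hf, hg]
    generalize RightComodule.coact (A := A) (C := C) u = x
    induction x using BT.induction with
    | zero => simp only [map_zero, add_zero]
    | tmul m n => simp only [rTensor_tmul, LinearMap.add_apply, BT.add_tmul]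
    | add x y hx hy => simp only [map_add, ← hx, ← hy]; abel
  neg_mem' {f} hf u := by
    rw [LinearMap.neg_apply, map_neg, hf]
    generalize RightComodule.coact (A := A) (C := C) u = x
    induction x using BT.induction with
    | zero => simp only [map_zero, neg_zero]
    | tmul m n =>
      exact (DFunLike.congr_fun (map_neg (BT.mk A (M := P) (N := C)) (f m)) n).symm
    | add x y hx hy => simp only [map_add, ← hx, ← hy]; abel

end Comodule

/-! ## Firm rings, firm modules and bicomodules -/

/-- `M` is a left module over the not necessarily unital ring `R`. -/
class NonUnitalModule (R M : Type u) [NonUnitalRing R] [AddCommGroup M] [SMul R M] : Prop where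
  smul_add : ∀ (r : R) (u v : M), r • (u + v) = r • u + r • v
  add_smul : ∀ (r s : R) (u : M), (r + s) • u = r • u + s • u
  mul_smul : ∀ (r s : R) (u : M), (r * s) • u = r • s • u

instance {R M : Type u} [Ring R] [AddCommGroup M] [Module R M] : NonUnitalModule R M where
  smul_add := _root_.smul_add
  add_smul := _root_.add_smul
  mul_smul := SemigroupAction.mul_smul

instance {R : Type u} [NonUnitalRing R] : NonUnitalModule R R where
  smul_add := mul_add
  add_smul := add_mul
  mul_smul := mul_assoc

/-- The multiplication map `R ⊗_R M → M`, `r ⊗ u ↦ r u`. -/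
def actMap (R M : Type u) [NonUnitalRing R] [AddCommGroup M] [SMul R M] [NonUnitalModule R M] :
    BT R R M →+ M :=
  BT.lift R
    (AddMonoidHom.mk' (fun r => AddMonoidHom.mk' (fun u => r • u) (NonUnitalModule.smul_add r))
      (fun r s => by ext u; exact NonUnitalModule.add_smul r s u))
    (fun r s u => NonUnitalModule.mul_smul r s u)

/-- The left `R`-module `M` is firm: the multiplication map `R ⊗_R M → M` is bijective. -/
def IsFirmModule (R M : Type u) [NonUnitalRing R] [AddCommGroup M] [SMul R M]
    [NonUnitalModule R M] : Prop :=
  Function.Bijective (actMap R M)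

/-- The ring `R` is firm: the multiplication map `R ⊗_R R → R` is bijective. -/
class FirmRing (R : Type u) [NonUnitalRing R] : Prop where
  firm : IsFirmModule R R

/-- Unital modules over unital rings are firm. -/
theorem isFirmModule_of_unital (R M : Type u) [Ring R] [AddCommGroup M] [Module R M] :
    IsFirmModule R M := by
  have key (x : BT R R M) : BT.tmul R (1 : R) (actMap R M x) = x := by
    induction x using BT.induction with
    | zero => rw [map_zero]; exact map_zero (BT.mk R (1 : R))
    | tmul r u =>
      have h := BT.smul_tmul R (1 : R) r u
      rw [op_smul_eq_mul, one_mul] at h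
      exact h.symm
    | add x y hx hy => rw [map_add, BT.tmul_add, hx, hy]
  exact ⟨fun x y h => by rw [← key x, h, key y], fun u => ⟨BT.tmul R 1 u, one_smul R u⟩⟩

instance {R : Type u} [Ring R] : FirmRing R := ⟨isFirmModule_of_unital R R⟩

section Bicomodule

variable (R A C P : Type u) [NonUnitalRing R] [Ring A] [AddCommGroup C] [Module A C]
  [Module Aᵐᵒᵖ C] [SMulCommClass A Aᵐᵒᵖ C] [Coring A C] [AddCommGroup P] [Module Aᵐᵒᵖ P]
  [RightComodule A C P] [SMul R P]

/-- The right `A`-linear map `u ↦ r u` on an `R`-`A`-bimodule `P`. -/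
def leftMul [NonUnitalModule R P] [SMulCommClass R Aᵐᵒᵖ P] (r : R) : P →ₗ[Aᵐᵒᵖ] P where
  toFun u := r • u
  map_add' := NonUnitalModule.smul_add r
  map_smul' a u := smul_comm r a u

/-- `P` is an `R`-`C`-bicomodule, i.e. an object of the category `_R M^C`: the right `C`-comodule
`P` is a firm left `R`-module, the actions of `R` and `A` commute, and the coaction is left
`R`-linear, i.e. `R` acts by right `C`-colinear maps. -/
class FirmBicomodule : Prop extends NonUnitalModule R P, SMulCommClass R Aᵐᵒᵖ P where
  firm : IsFirmModule R P
  colinear : ∀ r : R, IsColinear A C P (leftMul R A P r)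

/-- `P` is a bicomodule over its endomorphism ring `T = End^C(P)`. -/
instance : FirmBicomodule (ComoduleEnd A C P) A C P where
  smul_comm f a u := f.1.map_smul a u
  firm := isFirmModule_of_unital _ _
  colinear f := f.2

/-- The canonical ring morphism `R → T = End^C(P)`, `r ↦ (u ↦ r u)`. -/
def toComoduleEnd [FirmBicomodule R A C P] : R →ₙ+* ComoduleEnd A C P where
  toFun r := ⟨leftMul R A P r, FirmBicomodule.colinear r⟩
  map_zero' := by
    ext u
    have h := NonUnitalModule.add_smul (0 : R) 0 u
    rw [add_zero] at h
    exact left_eq_add.1 h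
  map_add' r s := by ext u; exact NonUnitalModule.add_smul r s u
  map_mul' r s := by ext u; exact NonUnitalModule.mul_smul r s u

/-- `R` is a left ideal in `T = End^C(P)`: the image of the canonical morphism `R → T` is one.
(In Mathlib an `Ideal` of a non-commutative ring is a left ideal.) -/
def IsLeftIdealInEnd [FirmBicomodule R A C P] : Prop :=
  ∃ I : Ideal (ComoduleEnd A C P), (I : Set (ComoduleEnd A C P)) = Set.range (toComoduleEnd R A C P)

end Bicomodule

/-! ## Comonadic-Galois comodules -/

/-- `Hom_A(P, M)`, the right `A`-linear maps. -/
def RHom (A P M : Type u) [Ring A] [AddCommGroup P] [Module Aᵐᵒᵖ P] [AddCommGroup M]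
    [Module Aᵐᵒᵖ M] : Type u :=
  P →ₗ[Aᵐᵒᵖ] M

/-- An element of `Hom_A(P, M)` as a linear map. -/
def RHom.toLinear {A P M : Type u} [Ring A] [AddCommGroup P] [Module Aᵐᵒᵖ P] [AddCommGroup M]
    [Module Aᵐᵒᵖ M] (f : RHom A P M) : P →ₗ[Aᵐᵒᵖ] M :=
  f

section Galois

variable (R A C P : Type u) [NonUnitalRing R] [Ring A] [AddCommGroup C] [Module A C]
  [Module Aᵐᵒᵖ C] [SMulCommClass A Aᵐᵒᵖ C] [Coring A C] [AddCommGroup P] [Module Aᵐᵒᵖ P]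
  [RightComodule A C P] [SMul R P] (M : Type u) [AddCommGroup M] [Module Aᵐᵒᵖ M]

instance : AddCommGroup (RHom A P M) := inferInstanceAs (AddCommGroup (P →ₗ[Aᵐᵒᵖ] M))

/-- The right action `(f r)(u) = f (r u)` of `R` on `Hom_A(P, M)`. -/
instance [NonUnitalModule R P] [SMulCommClass R Aᵐᵒᵖ P] : SMul Rᵐᵒᵖ (RHom A P M) where
  smul r f := LinearMap.comp f.toLinear (leftMul R A P r.unop)

instance [NonUnitalModule R P] [SMulCommClass R Aᵐᵒᵖ P] : NonUnitalModule Rᵐᵒᵖ (RHom A P M) where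
  smul_add _ _ _ := rfl
  add_smul r s f := LinearMap.ext fun u =>
    (congrArg f.toFun (NonUnitalModule.add_smul r.unop s.unop u)).trans (f.map_add _ _)
  mul_smul r s f := LinearMap.ext fun u =>
    congrArg f.toFun (NonUnitalModule.mul_smul s.unop r.unop u)

variable [FirmBicomodule R A C P]

/-- The canonical map `can_M : Hom_A(P, M) ⊗_R P → M ⊗_A C`, `f ⊗ u ↦ f(u₀) ⊗ u₁`, where
`ρ(u) = u₀ ⊗ u₁`. -/
def can : BT R (RHom A P M) P →ₗ[Aᵐᵒᵖ] BT A M C where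
  toFun := BT.lift R
    (AddMonoidHom.mk'
      (fun f : RHom A P M => (rTensor A C f.toLinear).comp (RightComodule.coact (A := A) (C := C) (P := P)))
      (fun f g => by
        ext u
        simp only [AddMonoidHom.comp_apply, AddMonoidHom.add_apply]
        generalize RightComodule.coact (A := A) (C := C) u = x
        induction x using BT.induction with
        | zero => simp only [map_zero, add_zero]
        | tmul m n => exact BT.add_tmul A _ _ n
        | add x y hx hy => simp only [map_add, hx, hy]; abel))
    (fun f r u => by
      simp only [AddMonoidHom.mk'_apply, AddMonoidHom.comp_apply]
      have h := FirmBicomodule.colinear (A := A) (C := C) r u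
      change _ = rTensor A C f.toLinear (RightComodule.coact (leftMul R A P r u))
      rw [h]
      generalize RightComodule.coact (A := A) (C := C) u = x
      induction x using BT.induction with
      | zero => simp only [map_zero]
      | tmul m n => rfl
      | add x y hx hy => simp only [map_add, hx, hy])
  map_add' := map_add _
  map_smul' a x := by
    have h (f : P →ₗ[Aᵐᵒᵖ] M) (x : BT A P C) : rTensor A C f (a • x) = a • rTensor A C f x := by
      induction x using BT.induction with
      | zero => simp only [smul_zero, map_zero]
      | tmul m n => rfl
      | add x y hx hy => simp only [smul_add, map_add, hx, hy]
    induction x using BT.induction with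
    | zero => simp only [smul_zero, map_zero]
    | tmul f u =>
      have h' := RightComodule.coact_right (C := C) a.unop u
      rw [op_unop] at h'
      change rTensor A C f.toLinear (RightComodule.coact (a • u)) =
        a • rTensor A C f.toLinear (RightComodule.coact u)
      rw [h', h]
    | add x y hx hy => simp only [smul_add, map_add, hx, hy]

/-- The `R`-`C`-bicomodule `P`, for a firm ring `R`, is an `R`-`C` comonadic-Galois comodule: the
natural map `can_M : Hom_A(P, M) ⊗_R P → M ⊗_A C` is an isomorphism for every right `A`-module `M`.
For `R = End^C(P)` this is a Galois comodule in the sense of Wisbauer. -/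
def IsComonadicGalois [FirmRing R] : Prop :=
  ∀ (M : Type u) [AddCommGroup M] [Module Aᵐᵒᵖ M], Function.Bijective (can R A C P M)

end Galois

/-! If `R` acts through `φ : R → S`, then `can_M` over `R` is `can_M` over `S` composed with the
surjection `Hom_A(P, M) ⊗_R P → Hom_A(P, M) ⊗_S P`. That surjection is injective when `⊗_R` is
already `S`-balanced. Since `P = R P`, balancedness only has to be checked on the elements `r u`;
if the image of `R` is a left ideal of `S`, then `s r` comes from `R`, so that
`f s ⊗ r u = f s r ⊗ u = f ⊗ s r u`. -/

namespace BT

theorem hom_ext {R M N Q : Type u} [AddCommGroup M] [AddCommGroup N] [AddCommGroup Q]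
    [SMul Rᵐᵒᵖ M] [SMul R N] {f g : BT R M N →+ Q}
    (h : ∀ m n, f (tmul R m n) = g (tmul R m n)) : f = g := by
  ext x
  induction x using BT.induction with
  | zero => rw [map_zero, map_zero]
  | tmul m n => exact h m n
  | add x y hx hy => rw [map_add, map_add, hx, hy]

section ChangeScalars

variable {R S M N : Type u} [AddCommGroup M] [AddCommGroup N] [SMul Rᵐᵒᵖ M] [SMul R N]
  [SMul Sᵐᵒᵖ M] [SMul S N] (φ : R → S) (hM : ∀ (r : R) (m : M), op (φ r) • m = op r • m)
  (hN : ∀ (r : R) (n : N), φ r • n = r • n)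

/-- The canonical map `M ⊗_R N → M ⊗_S N`, where `R` acts on `M` and `N` through `φ : R → S`. -/
def changeScalars : BT R M N →+ BT S M N :=
  lift R (mk S) fun m r n => by rw [mk_apply, mk_apply, ← hM, smul_tmul, hN]

theorem changeScalars_surjective : Function.Surjective (changeScalars φ hM hN) := by
  intro x
  induction x using BT.induction with
  | zero => exact (changeScalars φ hM hN).range.zero_mem
  | tmul m n => exact ⟨tmul R m n, rfl⟩
  | add x y hx hy => exact (changeScalars φ hM hN).range.add_mem hx hy

theorem changeScalars_injective
    (h : ∀ (m : M) (s : S) (n : N), tmul R (op s • m) n = tmul R m (s • n)) :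
    Function.Injective (changeScalars φ hM hN) := by
  have hcomp : (lift S (mk R) h).comp (changeScalars φ hM hN) = AddMonoidHom.id _ :=
    hom_ext fun _ _ => rfl
  exact Function.LeftInverse.injective (DFunLike.congr_fun hcomp)

end ChangeScalars

section MulMemRange

variable {R S M N : Type u} [NonUnitalRing R] [NonUnitalRing S] [AddCommGroup M] [AddCommGroup N]
  [SMul Rᵐᵒᵖ M] [SMul R N] [NonUnitalModule R N] [SMul Sᵐᵒᵖ M] [NonUnitalModule Sᵐᵒᵖ M]
  [SMul S N] [NonUnitalModule S N] {φ : R → S}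

theorem smul_tmul_of_mul_mem_range (hM : ∀ (r : R) (m : M), op (φ r) • m = op r • m)
    (hN : ∀ (r : R) (n : N), φ r • n = r • n)
    (hφ : ∀ (s : S) (r : R), s * φ r ∈ Set.range φ)
    (hRN : Function.Surjective (actMap R N)) (m : M) (s : S) (n : N) :
    tmul R (op s • m) n = tmul R m (s • n) := by
  have balanced_smul (r : R) (n : N) : tmul R (op s • m) (r • n) = tmul R m (s • r • n) := by
    obtain ⟨r', hr'⟩ := hφ s r
    calc tmul R (op s • m) (r • n)
        = tmul R (op r • op s • m) n := (smul_tmul R _ r n).symm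
      _ = tmul R (op r' • m) n := by
        rw [← hM, ← hM, hr', op_mul, NonUnitalModule.mul_smul]
      _ = tmul R m (r' • n) := smul_tmul R m r' n
      _ = tmul R m (s • r • n) := by rw [← hN r', hr', NonUnitalModule.mul_smul, hN]
  let smulHom : N →+ N := AddMonoidHom.mk' (s • ·) (NonUnitalModule.smul_add s)
  have hcomp : (mk R (op s • m)).comp (actMap R N) =
      ((mk R m).comp smulHom).comp (actMap R N) := hom_ext balanced_smul
  obtain ⟨x, rfl⟩ := hRN n
  exact DFunLike.congr_fun hcomp x

end MulMemRange

end BT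

section ChangeScalars

variable {A C R S P M : Type u} [Ring A] [AddCommGroup C] [Module A C] [Module Aᵐᵒᵖ C]
  [SMulCommClass A Aᵐᵒᵖ C] [Coring A C] [NonUnitalRing R] [NonUnitalRing S] [AddCommGroup P]
  [Module Aᵐᵒᵖ P] [SMul R P] [SMul S P] [AddCommGroup M] [Module Aᵐᵒᵖ M]

theorem RHom.op_smul_eq_of_smul_eq [NonUnitalModule R P] [SMulCommClass R Aᵐᵒᵖ P]
    [NonUnitalModule S P] [SMulCommClass S Aᵐᵒᵖ P] {φ : R → S}
    (hφ : ∀ (r : R) (u : P), φ r • u = r • u) (r : R) (f : RHom A P M) :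
    op (φ r) • f = op r • f :=
  LinearMap.ext fun u => congrArg f.toLinear (hφ r u)

variable [RightComodule A C P] [FirmBicomodule R A C P]

theorem toComoduleEnd_smul (r : R) (u : P) : toComoduleEnd R A C P r • u = r • u := rfl

theorem IsLeftIdealInEnd.mul_mem_range (h : IsLeftIdealInEnd R A C P) (t : ComoduleEnd A C P)
    (r : R) : t * toComoduleEnd R A C P r ∈ Set.range (toComoduleEnd R A C P) := by
  obtain ⟨I, hI⟩ := h
  exact hI.subset (I.mul_mem_left t (hI.superset ⟨r, rfl⟩))

variable [FirmBicomodule S A C P] {φ : R → S}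

theorem can_comp_changeScalars (hφ : ∀ (r : R) (u : P), φ r • u = r • u) :
    can S A C P M ∘ BT.changeScalars φ (RHom.op_smul_eq_of_smul_eq hφ) hφ = can R A C P M := by
  have hcomp : (can S A C P M).toAddMonoidHom.comp
      (BT.changeScalars φ (RHom.op_smul_eq_of_smul_eq hφ) hφ) = (can R A C P M).toAddMonoidHom :=
    BT.hom_ext fun _ _ => rfl
  exact congrArg DFunLike.coe hcomp

theorem theorem4p3_general (hφ : ∀ (r : R) (u : P), φ r • u = r • u) :
    (Function.Bijective (can R A C P M) → Function.Bijective (can S A C P M)) ∧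
      ((∀ (s : S) (r : R), s * φ r ∈ Set.range φ) →
        (Function.Bijective (can R A C P M) ↔ Function.Bijective (can S A C P M))) := by
  have hM := RHom.op_smul_eq_of_smul_eq (A := A) (M := M) hφ
  have hsurj := BT.changeScalars_surjective φ hM hφ
  rw [← can_comp_changeScalars hφ]
  refine ⟨fun h => (Function.Bijective.of_comp_iff _ ⟨h.injective.of_comp, hsurj⟩).1 h,
    fun hI => Function.Bijective.of_comp_iff _ ⟨?_, hsurj⟩⟩
  exact BT.changeScalars_injective φ hM hφ <|
    BT.smul_tmul_of_mul_mem_range hM hφ hI (FirmBicomodule.firm (A := A) (C := C)).surjective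

end ChangeScalars

theorem theorem4p3 {A C R P : Type u}
    [Ring A]
    -- `C` is an `A`-coring
    [AddCommGroup C] [Module A C] [Module Aᵐᵒᵖ C] [SMulCommClass A Aᵐᵒᵖ C] [Coring A C]
    -- `R` is a firm ring
    [NonUnitalRing R] [FirmRing R]
    -- `P` (the comodule `Σ` of the text) is an object of `_R M^C`
    [AddCommGroup P] [Module Aᵐᵒᵖ P] [RightComodule A C P] [SMul R P] [FirmBicomodule R A C P] :
    (IsComonadicGalois R A C P → IsComonadicGalois (ComoduleEnd A C P) A C P) ∧
      (IsLeftIdealInEnd R A C P →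
        (IsComonadicGalois R A C P ↔ IsComonadicGalois (ComoduleEnd A C P) A C P)) := by
  have general (M : Type u) [AddCommGroup M] [Module Aᵐᵒᵖ M] :=
    theorem4p3_general (A := A) (C := C) (M := M) (φ := toComoduleEnd R A C P) toComoduleEnd_smul
  exact ⟨fun h M _ _ => (general M).1 (h M),
    fun hI => forall₃_congr fun M _ _ => (general M).2 hI.mul_mem_range⟩
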